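/- Let $T$ be a diagram of an oriented virtual tangle with ordered components $T_1,\dots,T_n$, each either long (an arc) or closed, with a starting point on each closed component; a long component starts at its initial end. A crossing is a self-crossing if both strands belong to the same component and mixed otherwise. Fix integers $c_1,\dots,c_n$. *Labeling and polynomial.* Label $T_i$ by starting with $c_i$ at its starting point and propagating along the orientation. With both strands of a crossing drawn upwards, the label changes by $-1$ along the strand from bottom left to top right of a classical crossing, by $+1$ along the strand from bottom right to top left, and does not change at virtual crossings. At a positive crossing the overstrand is the one running from bottom left to top right, at a negative crossing it is the other one. Let $\delta_i$ be the final minus the initial label of $T_i$. The weight of a classical crossing $d$ is $W(d)=a-b-\mathrm{sgn}(d)$, where $a$, $b$ are the incoming labels of the over- and understrand. The multi-variable affine index polynomial (MAIP) is the Laurent polynomial $$p_T(t_1,\dots,t_n)=\sum_{i,j}\ \sum_{d:\ T_i\text{ over }T_j}\mathrm{sgn}(d)\,t_i^{\delta_j}\bigl(t_i^{W(d)}-1\bigr)$$ (sums over classical crossings $d$, with $i=j$ allowed). *Homological weights.* For two parts $A,B$ of a diagram meeting transversally, $A\cdot B$ is the sum, over the classical crossings of a strand of $A$ with a strand of $B$,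 of $+1$ if the directions ($A$, $B$) form a positive basis of the plane and $-1$ otherwise. Let $d$ be a classical crossing at which $T_i$ passes over $T_j$, and smooth $d$ respecting orientations. - If $i=j$, let $D_s$ be the component of the smoothed diagram containing the starting point of $T_i$ and $D$ the rest of the diagram; $W^h(d)=D\cdot D_s$. - If $i\ne j$ and $T_i,T_j$ are both long, let $D_+$ and $D_-$ be the components of the smoothed diagram that pass on the left and on the right of the smoothed crossing, and let $D_\varepsilon$ be the one with $\varepsilon=\mathrm{sgn}(d)$ and $D'$ the rest of the diagram; $W^h(d)=(c_i-c_j)+D'\cdot D_\varepsilon$. - If $i\ne j$ and at least one of $T_i,T_j$ is closed, first connect $T_i$ and $T_j$ right after their starting points by an orientation-preserving bridge (a strand arriving there along $T_i$ continues into $T_j$ and vice versa; the bridge meets other strands only in virtual crossings), then smooth $d$ and define $W^h(d)$ as in the previous case. A self-crossing of $T_i$ is an early under- (over-) crossing if $T_i$, followed from its starting point, first traverses it along the understrand (overstrand). **Claim.** The MAIP is expressed by the homological weights as $$p_T(t_1,\dots,t_n)=\sum_i\sum_{\substack{d\in T_i\\ \text{early undercr.}}}\mathrm{sgn}(d)\,t_i^{-W^h(d)+2\delta_i}+\sum_i\sum_{\substack{d\in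 T_i\\ \text{early overcr.}}}\mathrm{sgn}(d)\,t_i^{W^h(d)}+\sum_{i\ne j}\ \sum_{d:\ T_i\text{ over }T_j}\mathrm{sgn}(d)\,t_i^{W^h(d)}-\sum_{i,j}\ \sum_{d:\ T_i\text{ over }T_j}\mathrm{sgn}(d)\,t_i^{\delta_j}.$$ -/

import Mathlib

open scoped BigOperators

namespace VirtualTangle

/-- The decoration of a crossing (a 4-valent vertex) of a virtual tangle diagram. -/
inductive CrossingKind
  | positive
  | negative
  | virtual

/-- The two strands through a crossing of an oriented diagram. Turn the crossing so that both strands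
run upwards: `toRight` runs from bottom left to top right, `toLeft` from bottom right to top left. -/
inductive Strand
  | toRight
  | toLeft

/-- The other strand through the same crossing. -/
def Strand.other : Strand → Strand
  | .toRight => .toLeft
  | .toLeft => .toRight

/-- A diagram of an oriented virtual tangle with ordered components `T_0, …, T_{n-1}`, each of them
long (an arc) or closed (a circle with a chosen starting point), and with set of crossings `X`,
classical and virtual. Traversing component `i` from its starting point, one passes through crossings
`length i` times; `strandAt` records through which crossing, and along which of its two strands, every
such passage goes. Each strand of each crossing is traversed exactly once. -/
structure Diagram (n : ℕ) (X : Type*) where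
  kind : X → CrossingKind
  closed : Fin n → Prop
  length : Fin n → ℕ
  strandAt : (Σ i : Fin n, Fin (length i)) ≃ X × Strand

/-- The ring `ℤ[t_0^{±1}, …, t_{n-1}^{±1}]` of Laurent polynomials. -/
abbrev Laurent (n : ℕ) : Type := AddMonoidAlgebra ℤ (Fin n →₀ ℤ)

/-- The monomial `t_i ^ k`. -/
noncomputable def tpow {n : ℕ} (i : Fin n) (k : ℤ) : Laurent n :=
  AddMonoidAlgebra.single (Finsupp.single i k) 1

namespace Diagram

variable {n : ℕ} {X : Type*} (D : Diagram n X)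

/-- A passage `⟨i, k⟩`: the `k`-th time that component `i` goes through a crossing. -/
abbrev Passage : Type := Σ i : Fin n, Fin (D.length i)

/-- The passage that traverses strand `s` of the crossing `x`. -/
def passage (x : X) (s : Strand) : D.Passage := D.strandAt.symm (x, s)

/-- The crossing `x` is classical, that is, not virtual. -/
def Classical (x : X) : Prop := D.kind x ≠ CrossingKind.virtual

/-- The sign of a classical crossing (with value `0` at virtual crossings, which is never used). -/
def sgn (x : X) : ℤ :=
  match D.kind x with
  | .positive => 1
  | .negative => -1
  | .virtual => 0

/-- The overstrand of a classical crossing: at a positive crossing the strand running from bottom left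
to top right passes over, at a negative one the other strand does. (The value at virtual crossings
is never used.) -/
def overStrand (x : X) : Strand :=
  match D.kind x with
  | .positive => .toRight
  | .negative => .toLeft
  | .virtual => .toLeft

/-- The passage along the overstrand. -/
def overPassage (x : X) : D.Passage := D.passage x (D.overStrand x)

/-- The passage along the understrand. -/
def underPassage (x : X) : D.Passage := D.passage x (D.overStrand x).other

/-! ### The affine labeling and the polynomial -/

/-- The change of the label along a passage: `-1` when running from bottom left to top right through a
classical crossing, `+1` when running from bottom right to top left through one, and `0` at virtual
crossings. -/
def labelChange (p : D.Passage) : ℤ :=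
  match D.kind (D.strandAt p).1, (D.strandAt p).2 with
  | .virtual, _ => 0
  | _, .toRight => -1
  | _, .toLeft => 1

/-- The affine labeling with starting labels `c`. The passages cut component `i` into the arcs
`0, …, length i`, where arc `k` comes just before passage `k` and arc `k + 1` just after it;
arc `0` begins, and arc `length i` ends, at the starting point if the component is closed. -/
def label (c : Fin n → ℤ) (i : Fin n) (k : Fin (D.length i + 1)) : ℤ :=
  Fin.induction (motive := fun _ => ℤ) (c i) (fun m a => a + D.labelChange ⟨i, m⟩) k

/-- The label on the arc entering a passage. -/
def inLabel (c : Fin n → ℤ) (p : D.Passage) : ℤ := D.label c p.1 p.2.castSucc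

/-- The index difference `δ_i`: final label minus initial label of component `i`. -/
def indexDiff (c : Fin n → ℤ) (i : Fin n) : ℤ :=
  D.label c i (Fin.last (D.length i)) - D.label c i 0

/-- The weight `W(d) = a - b - sgn d`, for incoming labels `a` on the overstrand and `b` on the
understrand. -/
def weight (c : Fin n → ℤ) (d : X) : ℤ :=
  D.inLabel c (D.overPassage d) - D.inLabel c (D.underPassage d) - D.sgn d

open scoped Classical in
/-- The classical crossings at which `T_i` passes over `T_j`. -/
noncomputable def overCrossings [Fintype X] (i j : Fin n) : Finset X :=
  Finset.univ.filter fun d =>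
    D.Classical d ∧ (D.overPassage d).1 = i ∧ (D.underPassage d).1 = j

/-- The multi-variable affine index polynomial. -/
noncomputable def maip [Fintype X] (c : Fin n → ℤ) : Laurent n :=
  ∑ i, ∑ j, ∑ d ∈ D.overCrossings i j,
    D.sgn d • (tpow i (D.indexDiff c j) * (tpow i (D.weight c d) - 1))

open scoped Classical in
/-- The self-crossings of `T_i` at which `T_i`, from its starting point, runs along the understrand
before it runs along the overstrand. -/
noncomputable def earlyUnder [Fintype X] (i : Fin n) : Finset X :=
  (D.overCrossings i i).filter fun d =>
    ((D.underPassage d).2 : ℕ) < ((D.overPassage d).2 : ℕ)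

open scoped Classical in
/-- The self-crossings of `T_i` at which `T_i`, from its starting point, runs along the overstrand
before it runs along the understrand. -/
noncomputable def earlyOver [Fintype X] (i : Fin n) : Finset X :=
  (D.overCrossings i i).filter fun d =>
    ((D.overPassage d).2 : ℕ) < ((D.underPassage d).2 : ℕ)

/-! ### Smoothings, bridges and the homological weights -/

/-- The segments of the diagram: `initial i` is a short segment of `T_i` which begins at the starting
point, and is followed by the arcs `arc i 0, …, arc i (length i)`. -/
inductive Segment
  | initial (i : Fin n) : Segment
  | arc (i : Fin n) (k : Fin (D.length i + 1)) : Segment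

/-- The segment that enters a passage. -/
def inSeg (p : D.Passage) : D.Segment := .arc p.1 p.2.castSucc

/-- The segment that leaves a passage. -/
def outSeg (p : D.Passage) : D.Segment := .arc p.1 p.2.succ

/-- `Step d σ e e'`: in the diagram obtained by the oriented smoothing of the crossing `d`, the segment
`e` runs into the segment `e'`. Right after the starting points the strands are reconnected
according to `σ`: for `σ = 1` nothing is changed there, and for `σ = Equiv.swap i j` an orientation
preserving bridge is inserted between `T_i` and `T_j`. The virtual crossings of the bridge with
other strands do not affect how the strands are connected and are not recorded. -/
inductive Step (d : X) (σ : Equiv.Perm (Fin n)) : D.Segment → D.Segment → Prop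
  | through (p : D.Passage) (h : (D.strandAt p).1 ≠ d) : Step d σ (D.inSeg p) (D.outSeg p)
  | smooth (s : Strand) :
      Step d σ (D.inSeg (D.passage d s)) (D.outSeg (D.passage d s.other))
  | start (i : Fin n) : Step d σ (.initial i) (.arc (σ i) 0)
  | close (i : Fin n) (h : D.closed i) :
      Step d σ (.arc i (Fin.last (D.length i))) (.initial i)

/-- The component containing the segment `e` of the diagram smoothed at `d` and reconnected by `σ`. -/
def component (d : X) (σ : Equiv.Perm (Fin n)) (e : D.Segment) : Set D.Segment :=
  {e' | Relation.EqvGen (D.Step d σ) e e'}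

/-- The part on the left of the smoothed crossing `d`: it enters at the bottom left. -/
def leftHalf (d : X) (σ : Equiv.Perm (Fin n)) : Set D.Segment :=
  D.component d σ (D.inSeg (D.passage d .toRight))

/-- The part on the right of the smoothed crossing `d`: it enters at the bottom right. -/
def rightHalf (d : X) (σ : Equiv.Perm (Fin n)) : Set D.Segment :=
  D.component d σ (D.inSeg (D.passage d .toLeft))

/-- The half selected by the sign of `d`: left if `d` is positive, right if `d` is negative. -/
def signHalf (d : X) (σ : Equiv.Perm (Fin n)) : Set D.Segment :=
  match D.kind d with
  | .positive => D.leftHalf d σ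
  | .negative => D.rightHalf d σ
  | .virtual => ∅

open scoped Classical in
/-- The intersection pairing `A · B` of two parts (unions of components) of the diagram smoothed at
`d`. These parts, drawn on the surface of the virtual tangle, meet in the classical crossings other
than `d` of a strand of `A` with a strand of `B`; such a point counts `+1` if the directions of
(`A`, `B`) form a positive basis of the tangent plane, which means that `A` runs from bottom left to
top right and `B` from bottom right to top left, and `-1` otherwise. -/
noncomputable def pairing [Fintype X] (d : X) (A B : Set D.Segment) : ℤ :=
  ∑ x ∈ Finset.univ.filter (fun x => D.Classical x ∧ x ≠ d),
    ((if D.inSeg (D.passage x .toRight) ∈ A ∧ D.inSeg (D.passage x .toLeft) ∈ B then 1 else 0) -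
     (if D.inSeg (D.passage x .toLeft) ∈ A ∧ D.inSeg (D.passage x .toRight) ∈ B then 1 else 0))

open scoped Classical in
/-- The homological weight `W^h(d)` of a classical crossing `d` where `T_i` passes over `T_j`; in every
case the rest of the diagram is paired with one component of the smoothed diagram.
* Self-crossing: the component of the smoothed diagram that contains the starting point of `T_i`.
* Mixed crossing of two long components: the left or right half, according to the sign of `d`, and
  `c_i - c_j` is added.
* Mixed crossing with `T_i` or `T_j` closed: the same, after inserting a bridge between them. -/
noncomputable def homWeight [Fintype X] (c : Fin n → ℤ) (d : X) : ℤ :=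
  let i := (D.overPassage d).1
  let j := (D.underPassage d).1
  if i = j then
    D.pairing d (D.component d 1 (.initial i))ᶜ (D.component d 1 (.initial i))
  else if ¬ D.closed i ∧ ¬ D.closed j then
    (c i - c j) + D.pairing d (D.signHalf d 1)ᶜ (D.signHalf d 1)
  else
    (c i - c j) +
      D.pairing d (D.signHalf d (Equiv.swap i j))ᶜ (D.signHalf d (Equiv.swap i j))

end Diagram

end VirtualTangle

namespace VirtualTangle

/-! The two strands of a classical crossing change the label by opposite amounts, so pairing the
rest of the smoothed diagram with a part `S` gives the total label change along `S` away from `d`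
(`pairing_compl`). Crossings with both strands in `S` cancel.

Each component used in `homWeight` is a single path: along one strand up to `d`, then away along the
other strand to the end of its component (`component_eq_pathSegments`). Label changes telescope
along it (`pairing_pathSegments`). With incoming labels `a` (over, on `T_i`) and `b` (under, on
`T_j`), arriving by the overstrand gives `(a - c_i) + (δ_j + c_j - b - sgn d) = W + δ_j - (c_i -
c_j)`, and the term `c_i - c_j` in mixed weights removes the discrepancy. An early undercrossing
swaps the roles, so `W^h = -W + δ_i`. Either way `δ_j + W` is the claimed exponent. -/

instance : Fintype Strand :=
  ⟨⟨([Strand.toRight, Strand.toLeft] : List Strand), by simp⟩, fun s => by cases s <;> simp⟩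

theorem Strand.sum_univ {M : Type*} [AddCommMonoid M] (f : Strand → M) :
    ∑ s, f s = f .toRight + f .toLeft := by
  change (Multiset.map f ([Strand.toRight, Strand.toLeft] : List Strand)).sum = _
  simp

theorem Strand.eq_or_eq_other (s t : Strand) : s = t ∨ s = t.other := by
  cases s <;> cases t <;> simp [Strand.other]

theorem Strand.other_ne (s : Strand) : s.other ≠ s := by
  cases s <;> simp [Strand.other]

theorem Strand.other_other (s : Strand) : s.other.other = s := by
  cases s <;> rfl

theorem tpow_mul_tpow {n : ℕ} (i : Fin n) (a b : ℤ) :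
    tpow i a * tpow i b = tpow i (a + b) := by
  simp [tpow, AddMonoidAlgebra.single_mul_single, Finsupp.single_add]

namespace Diagram

variable {n : ℕ} {X : Type*} (D : Diagram n X)

@[simp]
theorem strandAt_passage (x : X) (s : Strand) : D.strandAt (D.passage x s) = (x, s) :=
  D.strandAt.apply_symm_apply _

theorem eq_passage (p : D.Passage) :
    p = D.passage (D.strandAt p).1 (D.strandAt p).2 :=
  (D.strandAt.symm_apply_apply p).symm

theorem passage_ne_other (x : X) (s : Strand) : D.passage x s ≠ D.passage x s.other := by
  intro h
  have := congrArg (fun p => (D.strandAt p).2) h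
  simp only [strandAt_passage] at this
  exact s.other_ne this.symm

theorem strandAt_fst_ne_iff (p : D.Passage) (x : X) (s : Strand) :
    (D.strandAt p).1 ≠ x ↔ p ≠ D.passage x s ∧ p ≠ D.passage x s.other := by
  constructor
  · intro h
    constructor <;> (rintro rfl; simp at h)
  · rintro ⟨h₁, h₂⟩ rfl
    rcases (D.strandAt p).2.eq_or_eq_other s with h | h
    · exact h₁ (by rw [← h]; exact D.eq_passage p)
    · exact h₂ (by rw [← h]; exact D.eq_passage p)

/-- Removes the dependent type, so that `omega` can decide where passages lie relative to `d`. -/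
theorem passage_ext_iff (p q : D.Passage) : p = q ↔ p.1 = q.1 ∧ (p.2 : ℕ) = q.2 := by
  constructor
  · rintro rfl
    exact ⟨rfl, rfl⟩
  · obtain ⟨i, k⟩ := p
    obtain ⟨j, l⟩ := q
    rintro ⟨h₁, h₂⟩
    dsimp only at h₁
    subst h₁
    exact congrArg _ (Fin.ext h₂)

/-! ### Telescoping the label -/

/-- The total label change along the first `m` passages of component `i`. -/
def prefixChange (i : Fin n) (m : ℕ) : ℤ :=
  ∑ k : Fin (D.length i), if (k : ℕ) < m then D.labelChange ⟨i, k⟩ else 0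

theorem prefixChange_zero (i : Fin n) : D.prefixChange i 0 = 0 := by
  simp [prefixChange]

theorem prefixChange_succ (i : Fin n) (k : Fin (D.length i)) :
    D.prefixChange i (k + 1) = D.prefixChange i k + D.labelChange ⟨i, k⟩ := by
  have h : D.labelChange ⟨i, k⟩ =
      ∑ l : Fin (D.length i), if l = k then D.labelChange ⟨i, l⟩ else 0 := by simp
  rw [h, prefixChange, prefixChange, ← Finset.sum_add_distrib]
  refine Finset.sum_congr rfl fun l _ => ?_
  rcases lt_trichotomy l k with hl | rfl | hl
  · have h₁ : (l : ℕ) < k := hl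
    rw [if_pos (by omega), if_pos h₁, if_neg hl.ne, add_zero]
  · simp
  · have h₁ : (k : ℕ) < l := hl
    rw [if_neg (by omega), if_neg (by omega), if_neg hl.ne', add_zero]

theorem label_eq (c : Fin n → ℤ) (i : Fin n) (k : Fin (D.length i + 1)) :
    D.label c i k = c i + D.prefixChange i k := by
  induction k using Fin.induction with
  | zero => simp [label, prefixChange_zero]
  | succ k ih =>
    have h : D.label c i k.succ = D.label c i k.castSucc + D.labelChange ⟨i, k⟩ := by
      simp [label]
    rw [h, ih, Fin.val_succ, prefixChange_succ, Fin.val_castSucc, add_assoc]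

theorem inLabel_eq (c : Fin n → ℤ) (p : D.Passage) :
    D.inLabel c p = c p.1 + D.prefixChange p.1 p.2 := by
  simp [inLabel, label_eq]

theorem indexDiff_eq (c : Fin n → ℤ) (i : Fin n) :
    D.indexDiff c i = D.prefixChange i (D.length i) := by
  simp [indexDiff, label_eq, prefixChange_zero]

theorem sum_passages_lt (i : Fin n) (m : ℕ) :
    (∑ p : D.Passage, if p.1 = i ∧ (p.2 : ℕ) < m then D.labelChange p else 0) =
      D.prefixChange i m := by
  rw [Fintype.sum_sigma, Finset.sum_eq_single i]
  · simp [prefixChange]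
  · intro j _ hj
    simp [hj]
  · simp

/-- Final label minus the label just after `q`; the change at `q` itself is excluded. -/
theorem sum_passages_gt (q : D.Passage) :
    (∑ p : D.Passage, if p.1 = q.1 ∧ (q.2 : ℕ) < p.2 then D.labelChange p else 0) =
      D.prefixChange q.1 (D.length q.1) - D.prefixChange q.1 q.2 - D.labelChange q := by
  have h := D.prefixChange_succ q.1 q.2
  rw [sub_sub, ← h, ← sum_passages_lt, ← sum_passages_lt, ← Finset.sum_sub_distrib]
  refine Finset.sum_congr rfl fun p _ => ?_
  by_cases hp : p.1 = q.1
  · have : (p.2 : ℕ) < D.length q.1 := hp ▸ p.2.2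
    by_cases hlt : (q.2 : ℕ) < p.2
    · rw [if_pos ⟨hp, hlt⟩, if_pos ⟨hp, this⟩, if_neg (by omega), sub_zero]
    · rw [if_neg (by omega), if_pos ⟨hp, this⟩, if_pos ⟨hp, by omega⟩, sub_self]
  · simp [hp]

/-! ### The pairing of a part with its complement -/

-- If one strand of `x` lies in `S`, the intersection sign is that strand's label change. If both
-- do, the changes `-1` and `+1` cancel, as they must since no strand is in the complement.
open scoped Classical in
theorem pairing_compl [Fintype X] (d : X) (S : Set D.Segment) :
    D.pairing d Sᶜ S = ∑ p : D.Passage,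
      if (D.strandAt p).1 ≠ d ∧ D.inSeg p ∈ S then D.labelChange p else 0 := by
  rw [← Equiv.sum_comp D.strandAt.symm, Fintype.sum_prod_type, pairing, Finset.sum_filter]
  refine Finset.sum_congr rfl fun x _ => ?_
  rw [Strand.sum_univ]
  change _ = (if (D.strandAt (D.passage x .toRight)).1 ≠ d ∧ _ then
      D.labelChange (D.passage x .toRight) else 0) +
    (if (D.strandAt (D.passage x .toLeft)).1 ≠ d ∧ _ then
      D.labelChange (D.passage x .toLeft) else 0)
  have h : (D.inSeg (D.strandAt.symm (x, .toRight)) = D.inSeg (D.passage x .toRight)) := rfl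
  have h' : (D.inSeg (D.strandAt.symm (x, .toLeft)) = D.inSeg (D.passage x .toLeft)) := rfl
  rw [h, h']
  simp only [labelChange, strandAt_passage, Classical, Set.mem_compl_iff]
  by_cases h₁ : x = d <;> by_cases h₂ : D.inSeg (D.passage x .toRight) ∈ S <;>
    by_cases h₃ : D.inSeg (D.passage x .toLeft) ∈ S <;>
    cases D.kind x <;> simp [h₁, h₂, h₃]

/-! ### The components of the smoothed diagram -/

/-- The path that runs into the segment `initial m`, along the component of `p` up to the passage `p`,
and from the passage `q` on along the component of `q`. -/
def pathSegments (m : Fin n) (p q : D.Passage) : Set D.Segment :=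
  {e | match e with
    | .initial i => i = m
    | .arc i k => (i = p.1 ∧ (k : ℕ) ≤ p.2) ∨ (i = q.1 ∧ (q.2 : ℕ) < k)}

@[simp]
theorem initial_mem_pathSegments {m i : Fin n} {p q : D.Passage} :
    Segment.initial i ∈ D.pathSegments m p q ↔ i = m := Iff.rfl

@[simp]
theorem arc_mem_pathSegments {m i : Fin n} {p q : D.Passage} {k : Fin (D.length i + 1)} :
    Segment.arc i k ∈ D.pathSegments m p q ↔
      (i = p.1 ∧ (k : ℕ) ≤ p.2) ∨ (i = q.1 ∧ (q.2 : ℕ) < k) := Iff.rfl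

theorem mem_iff_of_eqvGen {α : Type*} {r : α → α → Prop} {S : Set α}
    (h : ∀ a b, r a b → (a ∈ S ↔ b ∈ S)) {a b : α} (hab : Relation.EqvGen r a b) :
    a ∈ S ↔ b ∈ S := by
  induction hab with
  | rel a b hr => exact h a b hr
  | refl => exact Iff.rfl
  | symm _ _ _ ih => exact ih.symm
  | trans _ _ _ _ _ ih₁ ih₂ => exact ih₁.trans ih₂

section Component

variable {d : X} {s : Strand} {σ : Equiv.Perm (Fin n)} {m : Fin n}

/-- No step enters or leaves the path. `hm` says that `initial m` feeds the incoming strand, `hc`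
that a closed outgoing component returns to `initial m`, and `hlt` keeps the two pieces disjoint on
a self-crossing. -/
theorem step_pathSegments
    (hlt : (D.passage d s).1 = (D.passage d s.other).1 →
      ((D.passage d s).2 : ℕ) < (D.passage d s.other).2)
    (hm : σ m = (D.passage d s).1)
    (hc : ∀ i, D.closed i → (i = (D.passage d s.other).1 ↔ i = m))
    (e e' : D.Segment) (h : D.Step d σ e e') :
    e ∈ D.pathSegments m (D.passage d s) (D.passage d s.other) ↔
      e' ∈ D.pathSegments m (D.passage d s) (D.passage d s.other) := by
  cases h with
  | through r hr =>
    rw [D.strandAt_fst_ne_iff r d s, Ne, Ne, passage_ext_iff, passage_ext_iff] at hr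
    simp only [inSeg, outSeg, arc_mem_pathSegments, Fin.val_castSucc, Fin.val_succ]
    omega
  | smooth t =>
    have hs := s.other_other
    rcases t.eq_or_eq_other s with rfl | rfl
    · simp [inSeg, outSeg]
    · rw [hs]
      simp only [inSeg, outSeg, arc_mem_pathSegments, Fin.val_castSucc, Fin.val_succ]
      omega
  | start i =>
    have h₁ : i = m ↔ σ i = (D.passage d s).1 := by rw [← hm, σ.apply_eq_iff_eq]
    simp only [initial_mem_pathSegments, arc_mem_pathSegments, h₁]
    simp
  | close i hi =>
    rw [initial_mem_pathSegments, arc_mem_pathSegments, Fin.val_last, ← hc i hi]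
    -- The last arc lies beyond both passages, so it can be on the path only as part of the outgoing
    -- piece.
    have h₁ : i = (D.passage d s).1 → ((D.passage d s).2 : ℕ) < D.length i := by
      rintro rfl
      exact (D.passage d s).2.2
    have h₂ : i = (D.passage d s.other).1 → ((D.passage d s.other).2 : ℕ) < D.length i := by
      rintro rfl
      exact (D.passage d s.other).2.2
    omega

theorem eqvGen_arc_zero {i : Fin n} (k : Fin (D.length i + 1))
    (h : ∀ l : Fin (D.length i), (l : ℕ) < k → (D.strandAt ⟨i, l⟩).1 ≠ d) :
    Relation.EqvGen (D.Step d σ) (.arc i 0) (.arc i k) := by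
  induction k using Fin.induction with
  | zero => exact .refl _
  | succ k ih =>
    refine .trans _ _ _ (ih fun l hl => h l ?_) (.rel _ _ (.through ⟨i, k⟩ (h k ?_)))
    · rw [Fin.val_succ]
      exact Nat.lt_succ_of_lt hl
    · simp

theorem eqvGen_arc_succ {i : Fin n} (j : Fin (D.length i)) (k : Fin (D.length i + 1))
    (hk : (j : ℕ) < k)
    (h : ∀ l : Fin (D.length i), (j : ℕ) < l → (D.strandAt ⟨i, l⟩).1 ≠ d) :
    Relation.EqvGen (D.Step d σ) (.arc i j.succ) (.arc i k) := by
  induction k using Fin.induction with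
  | zero => simp at hk
  | succ k ih =>
    rw [Fin.val_succ] at hk
    rcases (Nat.lt_succ_iff.mp hk).eq_or_lt with hjk | hjk
    · rw [Fin.ext hjk]
      exact .refl _
    · exact .trans _ _ _ (ih hjk) (.rel _ _ (.through ⟨i, k⟩ (h k hjk)))

/-- Invariance under steps bounds the component from above; conversely every segment of the path is
joined to arc `0` of the incoming strand. -/
theorem component_eq_pathSegments
    (hlt : (D.passage d s).1 = (D.passage d s.other).1 →
      ((D.passage d s).2 : ℕ) < (D.passage d s.other).2)
    (hm : σ m = (D.passage d s).1)
    (hc : ∀ i, D.closed i → (i = (D.passage d s.other).1 ↔ i = m))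
    {e : D.Segment} (he : e ∈ D.pathSegments m (D.passage d s) (D.passage d s.other)) :
    D.component d σ e = D.pathSegments m (D.passage d s) (D.passage d s.other) := by
  have key : ∀ e ∈ D.pathSegments m (D.passage d s) (D.passage d s.other),
      Relation.EqvGen (D.Step d σ) (.arc (D.passage d s).1 0) e := by
    have hp : ∀ k : Fin (D.length (D.passage d s).1 + 1), (k : ℕ) ≤ (D.passage d s).2 →
        Relation.EqvGen (D.Step d σ) (.arc (D.passage d s).1 0) (.arc _ k) := by
      intro k hk
      refine D.eqvGen_arc_zero k fun l hl => ?_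
      rw [D.strandAt_fst_ne_iff _ d s, Ne, Ne, passage_ext_iff, passage_ext_iff]
      dsimp only
      omega
    rintro (i | ⟨i, k⟩) he
    · rw [initial_mem_pathSegments] at he
      subst he
      rw [← hm]
      exact (Relation.EqvGen.rel _ _ (.start i)).symm
    · rw [arc_mem_pathSegments] at he
      rcases he with ⟨rfl, hk⟩ | ⟨rfl, hk⟩
      · exact hp k hk
      · refine (hp (D.passage d s).2.castSucc le_rfl).trans _ _ _ ?_
        refine (Relation.EqvGen.rel _ _ (.smooth s)).trans _ _ _ ?_
        refine D.eqvGen_arc_succ _ k hk fun l hl => ?_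
        rw [D.strandAt_fst_ne_iff _ d s, Ne, Ne, passage_ext_iff, passage_ext_iff]
        dsimp only
        omega
  ext e'
  constructor
  · intro h
    exact (mem_iff_of_eqvGen (D.step_pathSegments hlt hm hc) h).mp he
  · intro h
    exact ((key e he).symm).trans _ _ _ (key e' h)

theorem pairing_pathSegments [Fintype X]
    (hlt : (D.passage d s).1 = (D.passage d s.other).1 →
      ((D.passage d s).2 : ℕ) < (D.passage d s.other).2) (c : Fin n → ℤ) :
    D.pairing d (D.pathSegments m (D.passage d s) (D.passage d s.other))ᶜ
        (D.pathSegments m (D.passage d s) (D.passage d s.other)) =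
      (D.inLabel c (D.passage d s) - c (D.passage d s).1) +
      (D.indexDiff c (D.passage d s.other).1 + c (D.passage d s.other).1 -
        D.inLabel c (D.passage d s.other) - D.labelChange (D.passage d s.other)) := by
  have h₁ := D.sum_passages_lt (D.passage d s).1 (D.passage d s).2
  have h₂ := D.sum_passages_gt (D.passage d s.other)
  rw [indexDiff_eq, inLabel_eq, inLabel_eq]
  -- The starting labels cancel, leaving only label changes.
  have h : ∀ a b x y z l : ℤ, a + x - a + (z + b - (b + y) - l) = x + (z - y - l) := by
    intros; ring
  rw [h, ← h₁, ← h₂, pairing_compl, ← Finset.sum_add_distrib]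
  refine Finset.sum_congr rfl fun r _ => ?_
  have hr : (D.strandAt r).1 ≠ d ∧
      D.inSeg r ∈ D.pathSegments m (D.passage d s) (D.passage d s.other) ↔
      (r.1 = (D.passage d s).1 ∧ (r.2 : ℕ) < (D.passage d s).2) ∨
        (r.1 = (D.passage d s.other).1 ∧ ((D.passage d s.other).2 : ℕ) < r.2) := by
    rw [D.strandAt_fst_ne_iff r d s, Ne, Ne, passage_ext_iff, passage_ext_iff, inSeg,
      arc_mem_pathSegments, Fin.val_castSucc]
    omega
  simp only [hr]
  split_ifs <;> omega

end Component

/-! ### The homological weights -/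

theorem labelChange_overPassage {d : X} (hd : D.Classical d) :
    D.labelChange (D.overPassage d) = -D.sgn d := by
  unfold Classical at hd
  unfold labelChange overPassage overStrand sgn
  cases h : D.kind d <;> simp_all

theorem labelChange_underPassage {d : X} (hd : D.Classical d) :
    D.labelChange (D.underPassage d) = D.sgn d := by
  unfold Classical at hd
  unfold labelChange underPassage overStrand sgn
  cases h : D.kind d <;> simp_all [Strand.other]

/-- The overstrand comes from the left at a positive crossing and from the right at a negative one,
so the sign always selects the half it enters. -/
theorem signHalf_eq {d : X} (hd : D.Classical d) (σ : Equiv.Perm (Fin n)) :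
    D.signHalf d σ = D.component d σ (D.inSeg (D.overPassage d)) := by
  unfold Classical at hd
  unfold signHalf overPassage overStrand leftHalf rightHalf
  cases h : D.kind d <;> simp_all

theorem overPassage_ne_underPassage (d : X) : D.overPassage d ≠ D.underPassage d :=
  D.passage_ne_other d _

variable [Fintype X] (c : Fin n → ℤ)

theorem homWeight_of_early_over {d : X} (hd : D.Classical d)
    (hi : (D.overPassage d).1 = (D.underPassage d).1)
    (hlt : ((D.overPassage d).2 : ℕ) < (D.underPassage d).2) :
    D.homWeight c d = D.weight c d + D.indexDiff c (D.underPassage d).1 := by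
  rw [homWeight]
  rw [if_pos hi, D.component_eq_pathSegments (s := D.overStrand d) (m := (D.overPassage d).1)
    (fun _ => hlt) rfl (fun i _ => by change i = (D.underPassage d).1 ↔ _; rw [hi])
    (D.initial_mem_pathSegments.mpr rfl), D.pairing_pathSegments (fun _ => hlt) c]
  change (D.inLabel c (D.overPassage d) - c (D.overPassage d).1) +
    (D.indexDiff c (D.underPassage d).1 + c (D.underPassage d).1 -
      D.inLabel c (D.underPassage d) - D.labelChange (D.underPassage d)) = _
  rw [labelChange_underPassage D hd, hi, weight]
  ring

theorem homWeight_of_early_under {d : X} (hd : D.Classical d)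
    (hi : (D.overPassage d).1 = (D.underPassage d).1)
    (hlt : ((D.underPassage d).2 : ℕ) < (D.overPassage d).2) :
    D.homWeight c d = -D.weight c d + D.indexDiff c (D.underPassage d).1 := by
  have ho : D.passage d (D.overStrand d).other.other = D.overPassage d := by
    rw [Strand.other_other, overPassage]
  have hlt' : (D.passage d (D.overStrand d).other).1 =
      (D.passage d (D.overStrand d).other.other).1 →
      ((D.passage d (D.overStrand d).other).2 : ℕ) <
        (D.passage d (D.overStrand d).other.other).2 := by
    rw [ho]
    exact fun _ => hlt
  rw [homWeight]
  -- The path from the starting point now reaches `d` along the understrand.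
  rw [if_pos hi, D.component_eq_pathSegments (s := (D.overStrand d).other)
    (m := (D.overPassage d).1) hlt' hi (fun i _ => by rw [ho])
    (D.initial_mem_pathSegments.mpr rfl), D.pairing_pathSegments hlt' c, ho]
  change (D.inLabel c (D.underPassage d) - c (D.underPassage d).1) +
    (D.indexDiff c (D.overPassage d).1 + c (D.overPassage d).1 -
      D.inLabel c (D.overPassage d) - D.labelChange (D.overPassage d)) = _
  rw [labelChange_overPassage D hd, hi, weight]
  ring

theorem homWeight_of_mixed {d : X} (hd : D.Classical d)
    (hi : (D.overPassage d).1 ≠ (D.underPassage d).1) :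
    D.homWeight c d = D.weight c d + D.indexDiff c (D.underPassage d).1 := by
  have key : ∀ (σ : Equiv.Perm (Fin n)) (m : Fin n), σ m = (D.overPassage d).1 →
      (∀ i, D.closed i → (i = (D.underPassage d).1 ↔ i = m)) →
      (c (D.overPassage d).1 - c (D.underPassage d).1) +
        D.pairing d (D.signHalf d σ)ᶜ (D.signHalf d σ) =
      D.weight c d + D.indexDiff c (D.underPassage d).1 := by
    intro σ m hm hc
    have hlt : (D.passage d (D.overStrand d)).1 = (D.passage d (D.overStrand d).other).1 →
        ((D.passage d (D.overStrand d)).2 : ℕ) < (D.passage d (D.overStrand d).other).2 :=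
      fun h => (hi h).elim
    rw [D.signHalf_eq hd, D.component_eq_pathSegments (s := D.overStrand d) hlt hm hc
      (e := D.inSeg (D.overPassage d)) (Or.inl ⟨rfl, le_rfl⟩), D.pairing_pathSegments hlt c]
    change _ + ((D.inLabel c (D.overPassage d) - c (D.overPassage d).1) +
      (D.indexDiff c (D.underPassage d).1 + c (D.underPassage d).1 -
        D.inLabel c (D.underPassage d) - D.labelChange (D.underPassage d))) = _
    rw [labelChange_underPassage D hd, weight]
    ring
  rw [homWeight]
  rw [if_neg hi]
  split_ifs with h
  -- Without a bridge the path starts at `initial i`; neither component is closed, so nothing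
  -- returns there.
  · refine key 1 (D.overPassage d).1 rfl fun i hcl => ?_
    constructor
    · rintro rfl
      exact (h.2 hcl).elim
    · rintro rfl
      exact (h.1 hcl).elim
  -- The bridge leads from the start of `T_j` into `T_i`, so the path runs through `initial j`,
  -- which is also where `T_j` returns if closed.
  · exact key _ (D.underPassage d).1 (Equiv.swap_apply_right _ _) fun i _ => Iff.rfl

/-! ### The polynomial -/

theorem mem_overCrossings {i j : Fin n} {d : X} :
    d ∈ D.overCrossings i j ↔
      D.Classical d ∧ (D.overPassage d).1 = i ∧ (D.underPassage d).1 = j := by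
  simp [overCrossings]

theorem sum_overCrossings_self {M : Type*} [AddCommMonoid M] (i : Fin n) (f : X → M) :
    ∑ d ∈ D.overCrossings i i, f d =
      (∑ d ∈ D.earlyUnder i, f d) + ∑ d ∈ D.earlyOver i, f d := by
  classical
  rw [← Finset.sum_filter_add_sum_filter_not (D.overCrossings i i)
    (fun d => ((D.underPassage d).2 : ℕ) < ((D.overPassage d).2 : ℕ))]
  congr 1
  · rw [earlyOver]
    refine Finset.sum_congr (Finset.filter_congr fun d hd => ?_) fun _ _ => rfl
    obtain ⟨-, h₁, h₂⟩ := D.mem_overCrossings.mp hd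
    have h := D.overPassage_ne_underPassage d
    rw [Ne, passage_ext_iff] at h
    omega

theorem sum_pairs {M : Type*} [AddCommMonoid M] (f : Fin n → Fin n → M) :
    ∑ i, ∑ j, f i j =
      ∑ i, f i i + ∑ i, ∑ j ∈ Finset.univ.filter (fun j => i ≠ j), f i j := by
  rw [← Finset.sum_add_distrib]
  refine Finset.sum_congr rfl fun i _ => ?_
  rw [← Finset.sum_filter_add_sum_filter_not Finset.univ (fun j => i = j) (f i)]
  simp [Finset.filter_eq]

theorem sum_smul_tpow_weight :
    (∑ i, ∑ j, ∑ d ∈ D.overCrossings i j,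
        D.sgn d • tpow i (D.weight c d + D.indexDiff c j)) =
      (∑ i, ∑ d ∈ D.earlyUnder i,
        D.sgn d • tpow i (-D.homWeight c d + 2 * D.indexDiff c i))
      + (∑ i, ∑ d ∈ D.earlyOver i, D.sgn d • tpow i (D.homWeight c d))
      + (∑ i, ∑ j ∈ Finset.univ.filter (fun j => i ≠ j), ∑ d ∈ D.overCrossings i j,
        D.sgn d • tpow i (D.homWeight c d)) := by
  rw [sum_pairs]
  congr 1
  · rw [← Finset.sum_add_distrib]
    refine Finset.sum_congr rfl fun i _ => ?_
    rw [sum_overCrossings_self]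
    congr 1
    · refine Finset.sum_congr rfl fun d hd => ?_
      obtain ⟨hd, hlt⟩ := Finset.mem_filter.mp hd
      obtain ⟨hd, h₁, h₂⟩ := D.mem_overCrossings.mp hd
      rw [D.homWeight_of_early_under c hd (h₁.trans h₂.symm) hlt, h₂]
      congr 2
      ring
    · refine Finset.sum_congr rfl fun d hd => ?_
      obtain ⟨hd, hlt⟩ := Finset.mem_filter.mp hd
      obtain ⟨hd, h₁, h₂⟩ := D.mem_overCrossings.mp hd
      rw [D.homWeight_of_early_over c hd (h₁.trans h₂.symm) hlt, h₂]
  · refine Finset.sum_congr rfl fun i _ => Finset.sum_congr rfl fun j hj =>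
      Finset.sum_congr rfl fun d hd => ?_
    obtain ⟨hcl, rfl, rfl⟩ := D.mem_overCrossings.mp hd
    rw [D.homWeight_of_mixed c hcl (Finset.mem_filter.mp hj).2]

end Diagram

end VirtualTangle

theorem mainTheorem6 {n : ℕ} {X : Type*} [Fintype X] (D : VirtualTangle.Diagram n X)
    (c : Fin n → ℤ) :
    D.maip c =
      (∑ i, ∑ d ∈ D.earlyUnder i,
          D.sgn d • VirtualTangle.tpow i (-D.homWeight c d + 2 * D.indexDiff c i))
      + (∑ i, ∑ d ∈ D.earlyOver i, D.sgn d • VirtualTangle.tpow i (D.homWeight c d))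
      + (∑ i, ∑ j ∈ Finset.univ.filter (fun j => i ≠ j), ∑ d ∈ D.overCrossings i j,
          D.sgn d • VirtualTangle.tpow i (D.homWeight c d))
      - (∑ i, ∑ j, ∑ d ∈ D.overCrossings i j,
          D.sgn d • VirtualTangle.tpow i (D.indexDiff c j)) := by
  rw [← D.sum_smul_tpow_weight c, VirtualTangle.Diagram.maip]
  simp only [← Finset.sum_sub_distrib]
  refine Finset.sum_congr rfl fun i _ => Finset.sum_congr rfl fun j _ =>
    Finset.sum_congr rfl fun d _ => ?_
  rw [mul_sub, mul_one, VirtualTangle.tpow_mul_tpow, smul_sub, add_comm]
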